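/- Let $\mathbb{Q}$ denote the real quaternions. A real random variable $\xi$ is sub-Gaussian if there is $c_0>0$ with $\mathbb{P}\{|\xi|>s\}\le \exp(1-c_0s^2)$ for all $s>0$, and $\|\xi\|_{\psi_2}:=\sup_{p\ge 1}p^{-1/2}(\mathbb{E}|\xi|^p)^{1/p}$. For a random vector $\mathbf{v}=v_w+v_x\mathbf{i}+v_y\mathbf{j}+v_z\mathbf{k}$ in $\mathbb{Q}^n$ write $\mathbf{v}_r=(v_w,v_x,v_y,v_z)\in\mathbb{R}^{4n}$; $\mathbf{v}$ is called sub-Gaussian if $\langle \mathbf{v}_r,x\rangle$ is sub-Gaussian for every $x\in\mathbb{R}^{4n}$, its sub-Gaussian norm is $\|\mathbf{v}\|_{\psi_2}:=\sup_{x\in\mathbb{R}^{4n},\,x^Tx=1}\|\langle \mathbf{v}_r,x\rangle\|_{\psi_2}$, and it is called isotropic if $\mathbb{E}\,\mathbf{v}_r\mathbf{v}_r^T=I_{4n}$. **Theorem (Deviation bound).** There are an absolute constant $c>0$ and, for each $K$, a constant $C_K>0$ depending only on $K$ such that the following holds. Let $n\ge 1$ and $N>4n$ be integers, let $\mathbf{A}$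 be a random matrix in $\mathbb{Q}^{N\times n}$ whose rows $\mathbf{A}_1,\dots,\mathbf{A}_N$ are independent sub-Gaussian isotropic random vectors in $\mathbb{Q}^n$, and let $K=\max_{1\le i\le N}\|\mathbf{A}_i\|_{\psi_2}$. Then for every $t>0$, with probability at least $1-\exp(-ct^2/K^4)$, $$2\sqrt{N}-2C_K\sqrt{n}-2t\;\le\;\sigma_{\min}(\mathbf{A})\;\le\;\sigma_{\max}(\mathbf{A})\;\le\;2\sqrt{N}+2C_K\sqrt{n}+2t,$$ where $\sigma_{\min}(\mathbf{A})$ and $\sigma_{\max}(\mathbf{A})$ are the smallest and the largest of the $n$ singular values of $\mathbf{A}$, i.e. of the nonnegative square roots of the eigenvalues of $\mathbf{A}^*\mathbf{A}$ acting on the right quaternion vector space $\mathbb{Q}^n$. -/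

import Mathlib

open MeasureTheory ProbabilityTheory
open scoped ENNReal Matrix

noncomputable section

/-- Quaternions carry their Borel σ-algebra. -/
instance Quaternion.instMeasurableSpaceReal : MeasurableSpace (Quaternion ℝ) :=
  borel (Quaternion ℝ)

instance Quaternion.instBorelSpaceReal : BorelSpace (Quaternion ℝ) := ⟨rfl⟩

namespace QuaternionSubGaussian

/-- A real random variable `ξ` is sub-Gaussian if `P(|ξ| > t) ≤ exp (1 - c t²)` for all `t > 0`
and some constant `c > 0`. -/
def IsSubGaussian {Ω : Type*} [MeasurableSpace Ω] (ξ : Ω → ℝ) (μ : Measure Ω) : Prop :=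
  ∃ c : ℝ, 0 < c ∧ ∀ t : ℝ, 0 < t → μ.real {ω | t < |ξ ω|} ≤ Real.exp (1 - c * t ^ 2)

/-- The sub-Gaussian norm `‖ξ‖_ψ₂ = sup_{p ≥ 1} p^{-1/2} (E |ξ|^p)^{1/p}`, as an element of
`[0, ∞]`. -/
def psi2Norm {Ω : Type*} [MeasurableSpace Ω] (ξ : Ω → ℝ) (μ : Measure Ω) : ℝ≥0∞ :=
  ⨆ (p : ℝ) (_ : 1 ≤ p),
    ENNReal.ofReal (p ^ (-(1 / 2) : ℝ)) * (∫⁻ ω, ENNReal.ofReal (|ξ ω| ^ p) ∂μ) ^ (1 / p : ℝ)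

/-- The real vector `v_r = [v_w; v_x; v_y; v_z] ∈ ℝ⁴ⁿ` of a quaternion vector `v`; the first
index selects the block. -/
def realVec {n : ℕ} (v : Fin n → Quaternion ℝ) : Fin 4 × Fin n → ℝ :=
  fun p => ![(v p.2).re, (v p.2).imI, (v p.2).imJ, (v p.2).imK] p.1

/-- A quaternion random vector is sub-Gaussian if all one-dimensional marginals `⟨v_r, x⟩`,
`x ∈ ℝ⁴ⁿ`, are sub-Gaussian. -/
def IsSubGaussianVec {Ω : Type*} [MeasurableSpace Ω] {n : ℕ} (v : Ω → Fin n → Quaternion ℝ)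
    (μ : Measure Ω) : Prop :=
  ∀ x : Fin 4 × Fin n → ℝ, IsSubGaussian (fun ω => realVec (v ω) ⬝ᵥ x) μ

/-- The sub-Gaussian norm of a quaternion random vector:
the supremum of `‖⟨v_r, x⟩‖_ψ₂` over the Euclidean unit sphere of `ℝ⁴ⁿ`. -/
def psi2NormVec {Ω : Type*} [MeasurableSpace Ω] {n : ℕ} (v : Ω → Fin n → Quaternion ℝ)
    (μ : Measure Ω) : ℝ≥0∞ :=
  ⨆ (x : Fin 4 × Fin n → ℝ) (_ : x ⬝ᵥ x = 1), psi2Norm (fun ω => realVec (v ω) ⬝ᵥ x) μ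

/-- A quaternion random vector is isotropic if `E v_r v_rᵀ = I₄ₙ`. -/
def IsIsotropic {Ω : Type*} [MeasurableSpace Ω] {n : ℕ} (v : Ω → Fin n → Quaternion ℝ)
    (μ : Measure Ω) : Prop :=
  ∀ p q : Fin 4 × Fin n, Integrable (fun ω => realVec (v ω) p * realVec (v ω) q) μ ∧
    ∫ ω, realVec (v ω) p * realVec (v ω) q ∂μ = if p = q then 1 else 0

/-- The largest sub-Gaussian norm of a row. -/
def maxRowPsi2Norm {Ω : Type*} [MeasurableSpace Ω] {N n : ℕ}
    (A : Ω → Matrix (Fin N) (Fin n) (Quaternion ℝ)) (μ : Measure Ω) : ℝ :=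
  (⨆ i : Fin N, psi2NormVec (fun ω => A ω i) μ).toReal

/-- The singular values of an `m × n` quaternion matrix with `m ≥ n`: the nonnegative square roots
of the eigenvalues of `Aᴴ A` acting on the right vector space of quaternion columns. For a
decomposition `A = U Σ Vᴴ` with `U`, `V` unitary these are exactly the `n` diagonal entries
of `Σ`. -/
def singularValues {m n : ℕ} (A : Matrix (Fin m) (Fin n) (Quaternion ℝ)) : Set ℝ :=
  {s : ℝ | 0 ≤ s ∧ ∃ x : Fin n → Quaternion ℝ, x ≠ 0 ∧ (Aᴴ * A) *ᵥ x = (s ^ 2) • x}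

/-- The largest singular value. -/
def sigmaMax {m n : ℕ} (A : Matrix (Fin m) (Fin n) (Quaternion ℝ)) : ℝ := sSup (singularValues A)

/-- The smallest singular value, for `m ≥ n`. -/
def sigmaMin {m n : ℕ} (A : Matrix (Fin m) (Fin n) (Quaternion ℝ)) : ℝ := sInf (singularValues A)

end QuaternionSubGaussian

end

/-! Put `r = 2√N` and `δ = (C_K √n + t)/√N`. If the real operator `AᴴA - r²` has norm at most `r²
max(δ, δ²)`, every singular value lies within `rδ = 2 C_K √n + 2t` of `r`
(`abs_singularValue_sub_le`). This operator is symmetric on a real space of dimension `4n`, so its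
norm is controlled by `‖Ay‖² - 4N` for `y` in a net of at most `5^(4n)` unit vectors
(`exists_half_net_sphere`, `norm_le_of_half_net`).

For fixed unit `y`, `‖Ay‖²` is a sum over independent rows, and each row contributes the squares of
four real marginals in unit directions (`norm_sq_dotProduct_eq`). By isotropy each square has mean
one, and its centred moment generating function is Gaussian near zero (`mgf_sq_sub_one_le`).
Bernstein's inequality and a union bound over the net finish the proof; the term `C_K √n` pays for
the size of the net (`net_card_mul_exp_le`). -/

namespace QuaternionSubGaussian

/-! ### From the sub-Gaussian norm to moment generating functions. -/

/-- The `p`-th moment bound encoded in the sub-Gaussian norm. -/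
lemma lintegral_even_pow_le {Ω : Type*} [MeasurableSpace Ω] {μ : Measure Ω} {ξ : Ω → ℝ} {K : ℝ}
    (hK : 0 ≤ K) (h : psi2Norm ξ μ ≤ ENNReal.ofReal K) {m : ℕ} (hm : 1 ≤ m) :
    ∫⁻ ω, ENNReal.ofReal (ξ ω ^ (2 * m)) ∂μ ≤ ENNReal.ofReal (K ^ (2 * m) * (2 * m : ℝ) ^ m) := by
  have hm' : (1 : ℝ) ≤ m := by exact_mod_cast hm
  have hp0 : (0 : ℝ) < 2 * m := by linarith
  have hb := (le_iSup₂_of_le (f := fun (p : ℝ) (_ : 1 ≤ p) =>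
    ENNReal.ofReal (p ^ (-(1 / 2) : ℝ)) * (∫⁻ ω, ENNReal.ofReal (|ξ ω| ^ p) ∂μ) ^ (1 / p : ℝ))
    (2 * m : ℝ) (by linarith) le_rfl).trans h
  have hI : ∀ ω, |ξ ω| ^ (2 * m : ℝ) = ξ ω ^ (2 * m) := fun ω => by
    rw [show (2 * m : ℝ) = ((2 * m : ℕ) : ℝ) by push_cast; rfl, Real.rpow_natCast, pow_mul, sq_abs,
      pow_mul]
  simp only [hI] at hb
  set I := ∫⁻ ω, ENNReal.ofReal (ξ ω ^ (2 * m)) ∂μ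
  have h1 : I ^ (1 / (2 * m) : ℝ) ≤ ENNReal.ofReal (K * (2 * m : ℝ) ^ (1 / 2 : ℝ)) := by
    calc I ^ (1 / (2 * m) : ℝ)
        = ENNReal.ofReal ((2 * m : ℝ) ^ (1 / 2 : ℝ)) *
          (ENNReal.ofReal ((2 * m : ℝ) ^ (-(1 / 2) : ℝ)) * I ^ (1 / (2 * m) : ℝ)) := by
          rw [← mul_assoc, ← ENNReal.ofReal_mul (by positivity), ← Real.rpow_add hp0]
          simp
      _ ≤ ENNReal.ofReal ((2 * m : ℝ) ^ (1 / 2 : ℝ)) * ENNReal.ofReal K := by gcongr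
      _ = _ := by rw [← ENNReal.ofReal_mul (by positivity), mul_comm]
  have h2 := ENNReal.rpow_le_rpow h1 hp0.le
  rw [← ENNReal.rpow_mul, one_div_mul_cancel hp0.ne', ENNReal.rpow_one,
    ENNReal.ofReal_rpow_of_nonneg (by positivity) hp0.le] at h2
  refine h2.trans (le_of_eq ?_)
  congr 1
  rw [Real.mul_rpow hK (by positivity), ← Real.rpow_mul hp0.le,
    show (1 / 2 : ℝ) * (2 * m) = m by ring, Real.rpow_natCast,
    show (2 * m : ℝ) = ((2 * m : ℕ) : ℝ) by push_cast; rfl, Real.rpow_natCast]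

/-- In the power series of the exponential, the even-moment bound and `m^m / m! ≤ e^m ≤ 3^m` make
the `m`-th term at most `2^(-m)`. The constant 12 is what gives ratio `1/2`. -/
lemma lintegral_exp_sq_le {Ω : Type*} [MeasurableSpace Ω] {μ : Measure Ω} [IsProbabilityMeasure μ]
    {ξ : Ω → ℝ} (hξ : Measurable ξ) {K : ℝ} (hK : 0 < K) (h : psi2Norm ξ μ ≤ ENNReal.ofReal K) :
    ∫⁻ ω, ENNReal.ofReal (Real.exp (ξ ω ^ 2 / (12 * K ^ 2))) ∂μ ≤ 2 := by
  have hterm : ∀ ω (m : ℕ), 0 ≤ (ξ ω ^ 2 / (12 * K ^ 2)) ^ m / (m.factorial : ℝ) :=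
    fun ω m => by positivity
  have hexp : ∀ ω, ENNReal.ofReal (Real.exp (ξ ω ^ 2 / (12 * K ^ 2))) =
      ∑' m : ℕ, ENNReal.ofReal ((ξ ω ^ 2 / (12 * K ^ 2)) ^ m / (m.factorial : ℝ)) := fun ω => by
    rw [← ENNReal.ofReal_tsum_of_nonneg (hterm ω) (Real.summable_pow_div_factorial _),
      Real.exp_eq_exp_ℝ, NormedSpace.exp_eq_tsum_div]
  simp only [hexp]
  rw [lintegral_tsum (fun m => by fun_prop)]
  calc ∑' m : ℕ, ∫⁻ ω, ENNReal.ofReal ((ξ ω ^ 2 / (12 * K ^ 2)) ^ m / (m.factorial : ℝ)) ∂μ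
      ≤ ∑' m : ℕ, (2⁻¹ : ℝ≥0∞) ^ m := ENNReal.tsum_le_tsum fun m => ?_
    _ = 2 := by rw [ENNReal.tsum_geometric, ENNReal.one_sub_inv_two, inv_inv]
  rcases Nat.eq_zero_or_pos m with rfl | hm
  · simp
  have hfac : (m : ℝ) ^ m / (m.factorial : ℝ) ≤ 3 ^ m := by
    refine (Real.pow_div_factorial_le_exp _ (Nat.cast_nonneg m) m).trans ?_
    rw [← Real.exp_one_pow]
    exact pow_le_pow_left₀ (Real.exp_pos _).le Real.exp_one_lt_three.le _
  have hsplit : ∀ ω, ENNReal.ofReal ((ξ ω ^ 2 / (12 * K ^ 2)) ^ m / (m.factorial : ℝ)) =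
      ENNReal.ofReal (1 / ((12 * K ^ 2) ^ m * (m.factorial : ℝ))) *
        ENNReal.ofReal (ξ ω ^ (2 * m)) := fun ω => by
    rw [← ENNReal.ofReal_mul (by positivity), div_pow, pow_mul]
    congr 1
    field_simp
  simp only [hsplit]
  rw [lintegral_const_mul _ (by fun_prop)]
  calc _ ≤ ENNReal.ofReal (1 / ((12 * K ^ 2) ^ m * (m.factorial : ℝ))) *
        ENNReal.ofReal (K ^ (2 * m) * (2 * m : ℝ) ^ m) := by
        gcongr
        exact lintegral_even_pow_le hK.le h hm
    _ = ENNReal.ofReal ((1 / 6) ^ m * ((m : ℝ) ^ m / (m.factorial : ℝ))) := by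
        rw [← ENNReal.ofReal_mul (by positivity)]
        congr 1
        rw [show (12 : ℝ) = 2 * 6 by norm_num, mul_pow, mul_pow, mul_pow, pow_mul, div_pow, one_pow]
        field_simp
    _ ≤ ENNReal.ofReal ((1 / 6) ^ m * 3 ^ m) := by gcongr
    _ = (2⁻¹ : ℝ≥0∞) ^ m := by
        rw [← mul_pow, ENNReal.ofReal_pow (by norm_num), show (1 / 6 * 3 : ℝ) = 2⁻¹ by norm_num,
          ENNReal.ofReal_inv_of_pos (by norm_num)]
        simp

lemma integrable_exp_sq {Ω : Type*} [MeasurableSpace Ω] {μ : Measure Ω} [IsProbabilityMeasure μ]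
    {ξ : Ω → ℝ} (hξ : Measurable ξ) {K : ℝ} (hK : 0 < K) (h : psi2Norm ξ μ ≤ ENNReal.ofReal K) :
    Integrable (fun ω => Real.exp (ξ ω ^ 2 / (12 * K ^ 2))) μ ∧
      ∫ ω, Real.exp (ξ ω ^ 2 / (12 * K ^ 2)) ∂μ ≤ 2 := by
  have h2 := lintegral_exp_sq_le hξ hK h
  have hm : Measurable (fun ω => Real.exp (ξ ω ^ 2 / (12 * K ^ 2))) := by fun_prop
  constructor
  · refine ⟨hm.aestronglyMeasurable, ?_⟩
    rw [hasFiniteIntegral_iff_ofReal (.of_forall fun _ => (Real.exp_pos _).le)]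
    exact h2.trans_lt (by simp)
  · rw [integral_eq_lintegral_of_nonneg_ae (.of_forall fun _ => (Real.exp_pos _).le)
      hm.aestronglyMeasurable]
    exact ENNReal.toReal_mono (by simp) h2

lemma exp_le_one_add_add_sq_mul_exp_abs (u : ℝ) :
    Real.exp u ≤ 1 + u + u ^ 2 * Real.exp |u| := by
  have := Complex.norm_exp_sub_sum_le_norm_mul_exp (u : ℂ) 2
  simp only [Finset.sum_range_succ, Finset.sum_range_zero] at this
  norm_num at this
  rw [← Complex.ofReal_exp, ← Complex.ofReal_one, ← Complex.ofReal_add, ← Complex.ofReal_sub,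
    Complex.norm_real, Real.norm_eq_abs] at this
  linarith [le_abs_self (Real.exp u - (1 + u))]

/-- The exponent `p = 2` in the supremum gives `E ξ² ≤ 2K²`. This keeps `K` away from zero, so `K²`
can be absorbed into `K⁴`. -/
lemma one_le_two_mul_sq_of_variance {Ω : Type*} [MeasurableSpace Ω] {μ : Measure Ω} {ξ : Ω → ℝ}
    {K : ℝ} (hK : 0 ≤ K) (h : psi2Norm ξ μ ≤ ENNReal.ofReal K)
    (hint : Integrable (fun ω => ξ ω ^ 2) μ) (hvar : ∫ ω, ξ ω ^ 2 ∂μ = 1) : 1 ≤ 2 * K ^ 2 := by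
  have h1 := lintegral_even_pow_le hK h le_rfl
  simp only [mul_one, Nat.cast_one, pow_one] at h1
  rw [← ofReal_integral_eq_lintegral_ofReal hint (.of_forall fun _ => sq_nonneg _), hvar,
    ENNReal.ofReal_le_ofReal_iff (by positivity)] at h1
  linarith

/-- The moment generating function of the centred square of a sub-Gaussian variable of unit
variance. -/
lemma mgf_sq_sub_one_le {Ω : Type*} [MeasurableSpace Ω] {μ : Measure Ω} [IsProbabilityMeasure μ]
    {ξ : Ω → ℝ} (hξ : Measurable ξ) {K : ℝ} (hK : 0 < K) (h : psi2Norm ξ μ ≤ ENNReal.ofReal K)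
    (hint : Integrable (fun ω => ξ ω ^ 2) μ) (hvar : ∫ ω, ξ ω ^ 2 ∂μ = 1) {s : ℝ}
    (hs : |s| ≤ 1 / (24 * K ^ 2)) :
    Integrable (fun ω => Real.exp (s * (ξ ω ^ 2 - 1))) μ ∧
      ∫ ω, Real.exp (s * (ξ ω ^ 2 - 1)) ∂μ ≤ Real.exp (4608 * s ^ 2 * K ^ 4) := by
  obtain ⟨hE, hE2⟩ := integrable_exp_sq hξ hK h
  have hK2 := one_le_two_mul_sq_of_variance hK.le h hint hvar
  set a := 1 / (24 * K ^ 2) with ha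
  have ha0 : 0 < a := by positivity
  have ha6 : 2 * a ≤ 1 / 6 := by
    rw [ha, ← mul_div_assoc, div_le_div_iff₀ (by positivity) (by norm_num)]
    linarith
  have hexp : Real.exp (2 * a) ≤ 2 := by
    refine (Real.exp_le_exp.2 ha6).trans ?_
    have := Real.exp_bound_div_one_sub_of_interval (x := 1 / 6) (by norm_num) (by norm_num)
    norm_num at this ⊢
    linarith
  -- The linear Taylor term has mean zero. In the remainder, `(a|z|)² ≤ 2 exp(a|z|)` and `|s| ≤ a`
  -- leave `exp(2a|z|)`, where `2a = 1/(12K²)` is exactly the integrable exponent.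
  have hpt : ∀ ω, Real.exp (s * (ξ ω ^ 2 - 1)) ≤ 1 + s * (ξ ω ^ 2 - 1) +
      (4 * (s / a) ^ 2) * Real.exp (ξ ω ^ 2 / (12 * K ^ 2)) := fun ω => by
    set z := ξ ω ^ 2 - 1
    have hz : |z| ≤ ξ ω ^ 2 + 1 := by
      rw [abs_le]; constructor <;> simp only [z] <;> nlinarith [sq_nonneg (ξ ω)]
    have h1 := exp_le_one_add_add_sq_mul_exp_abs (s * z)
    have h2 : (a * |z|) ^ 2 ≤ 2 * Real.exp (a * |z|) := by
      have := Real.quadratic_le_exp_of_nonneg (x := a * |z|) (by positivity)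
      nlinarith [mul_nonneg ha0.le (abs_nonneg z)]
    have h3 : Real.exp |s * z| ≤ Real.exp (a * |z|) := by
      rw [abs_mul]; gcongr
    have h4 : (s * z) ^ 2 = (s / a) ^ 2 * (a * |z|) ^ 2 := by
      rw [mul_pow a, sq_abs]; field_simp
    have h5 : (s * z) ^ 2 * Real.exp |s * z| ≤
        (4 * (s / a) ^ 2) * Real.exp (ξ ω ^ 2 / (12 * K ^ 2)) := by
      calc (s * z) ^ 2 * Real.exp |s * z|
          ≤ (s / a) ^ 2 * (2 * Real.exp (a * |z|)) * Real.exp (a * |z|) := by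
            rw [h4]; gcongr
        _ = (s / a) ^ 2 * 2 * Real.exp (2 * a * |z|) := by
            rw [show 2 * a * |z| = a * |z| + a * |z| by ring, Real.exp_add]; ring
        _ ≤ (s / a) ^ 2 * 2 * Real.exp (2 * a * (ξ ω ^ 2 + 1)) := by gcongr
        _ = (s / a) ^ 2 * 2 * (Real.exp (ξ ω ^ 2 / (12 * K ^ 2)) * Real.exp (2 * a)) := by
            rw [← Real.exp_add, show 2 * a * (ξ ω ^ 2 + 1) = ξ ω ^ 2 / (12 * K ^ 2) + 2 * a by
              rw [ha]; field_simp; ring]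
        _ ≤ (s / a) ^ 2 * 2 * (Real.exp (ξ ω ^ 2 / (12 * K ^ 2)) * 2) := by gcongr
        _ = _ := by ring
    linarith
  have hcent : Integrable (fun ω => s * (ξ ω ^ 2 - 1)) μ :=
    (hint.sub (integrable_const _)).const_mul _
  have hlin : Integrable (fun ω => 1 + s * (ξ ω ^ 2 - 1)) μ := (integrable_const _).add hcent
  have hR := hlin.add (hE.const_mul (4 * (s / a) ^ 2))
  have hL : Integrable (fun ω => Real.exp (s * (ξ ω ^ 2 - 1))) μ :=
    hR.mono' (by fun_prop) (.of_forall fun ω => by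
      rw [Real.norm_eq_abs, abs_of_pos (Real.exp_pos _)]; exact hpt ω)
  refine ⟨hL, ?_⟩
  calc ∫ ω, Real.exp (s * (ξ ω ^ 2 - 1)) ∂μ
      ≤ ∫ ω, (1 + s * (ξ ω ^ 2 - 1) +
        (4 * (s / a) ^ 2) * Real.exp (ξ ω ^ 2 / (12 * K ^ 2))) ∂μ := integral_mono hL hR hpt
    _ = 1 + (4 * (s / a) ^ 2) * ∫ ω, Real.exp (ξ ω ^ 2 / (12 * K ^ 2)) ∂μ := by
      rw [integral_add hlin (hE.const_mul _), integral_add (integrable_const _) hcent,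
        integral_const_mul,
        integral_const_mul, integral_sub hint (integrable_const _), hvar]
      simp
    _ ≤ 4608 * s ^ 2 * K ^ 4 + 1 := by
      have : (4 * (s / a) ^ 2) * ∫ ω, Real.exp (ξ ω ^ 2 / (12 * K ^ 2)) ∂μ ≤
        (4 * (s / a) ^ 2) * 2 := by gcongr
      have h' : (4 * (s / a) ^ 2) * 2 = 4608 * s ^ 2 * K ^ 4 := by
        rw [ha]; field_simp; ring
      linarith
    _ ≤ _ := Real.add_one_le_exp _

/-- By convexity, the bound for one centred square passes to the sum of four of them. -/
lemma mgf_sum_four_sq_le {Ω : Type*} [MeasurableSpace Ω] {μ : Measure Ω} [IsProbabilityMeasure μ]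
    {ξ : Fin 4 → Ω → ℝ} (hξ : ∀ k, Measurable (ξ k)) {K : ℝ} (hK : 0 < K)
    (h : ∀ k, psi2Norm (ξ k) μ ≤ ENNReal.ofReal K)
    (hint : ∀ k, Integrable (fun ω => ξ k ω ^ 2) μ) (hvar : ∀ k, ∫ ω, ξ k ω ^ 2 ∂μ = 1) {s : ℝ}
    (hs : |s| ≤ 1 / (96 * K ^ 2)) :
    Integrable (fun ω => Real.exp (s * (∑ k, ξ k ω ^ 2 - 4))) μ ∧
      ∫ ω, Real.exp (s * (∑ k, ξ k ω ^ 2 - 4)) ∂μ ≤ Real.exp (73728 * s ^ 2 * K ^ 4) := by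
  have hs4 : |4 * s| ≤ 1 / (24 * K ^ 2) := by
    rw [abs_mul, abs_of_pos (by norm_num : (0 : ℝ) < 4)]
    calc 4 * |s| ≤ 4 * (1 / (96 * K ^ 2)) := by gcongr
      _ = 1 / (24 * K ^ 2) := by field_simp; norm_num
  have hk := fun k => mgf_sq_sub_one_le (hξ k) hK (h k) (hint k) (hvar k) hs4
  -- The four variables need not be independent, so Jensen with weights `1/4` replaces a product;
  -- the price is `4s` in place of `s`.
  have hpt : ∀ ω, Real.exp (s * (∑ k, ξ k ω ^ 2 - 4)) ≤
      ∑ k, (1 / 4) * Real.exp (4 * s * (ξ k ω ^ 2 - 1)) := fun ω => by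
    have := convexOn_exp.map_sum_le (t := Finset.univ) (w := fun _ : Fin 4 => (1 / 4 : ℝ))
      (p := fun k => 4 * s * (ξ k ω ^ 2 - 1)) (by intros; norm_num) (by norm_num)
      (by intros; trivial)
    simp only [smul_eq_mul] at this
    refine (le_of_eq ?_).trans this
    congr 1
    simp only [Fin.sum_univ_four]
    ring
  have hR : Integrable (fun ω => ∑ k, (1 / 4) * Real.exp (4 * s * (ξ k ω ^ 2 - 1))) μ :=
    integrable_finsetSum _ fun k _ => (hk k).1.const_mul _
  have hL : Integrable (fun ω => Real.exp (s * (∑ k, ξ k ω ^ 2 - 4))) μ :=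
    hR.mono' (by fun_prop) (.of_forall fun ω => by
      rw [Real.norm_eq_abs, abs_of_pos (Real.exp_pos _)]; exact hpt ω)
  refine ⟨hL, (integral_mono hL hR hpt).trans ?_⟩
  rw [integral_finsetSum _ fun k _ => (hk k).1.const_mul _]
  calc ∑ k, ∫ ω, 1 / 4 * Real.exp (4 * s * (ξ k ω ^ 2 - 1)) ∂μ
      ≤ ∑ _k : Fin 4, 1 / 4 * Real.exp (4608 * (4 * s) ^ 2 * K ^ 4) := by
        refine Finset.sum_le_sum fun k _ => ?_
        rw [integral_const_mul]
        exact mul_le_mul_of_nonneg_left (hk k).2 (by norm_num)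
    _ = _ := by
        rw [Finset.sum_const, Finset.card_univ, Fintype.card_fin,
          show 4608 * (4 * s) ^ 2 * K ^ 4 = 73728 * s ^ 2 * K ^ 4 by ring, nsmul_eq_mul]
        norm_num
        ring

/-! ### Bernstein's inequality. -/

/-- Bernstein's inequality for sums of independent variables whose moment generating functions
are bounded near the origin. -/
lemma measure_abs_sum_ge_le {Ω : Type*} [MeasurableSpace Ω] {μ : Measure Ω}
    [IsProbabilityMeasure μ] {N : ℕ} {Z : Fin N → Ω → ℝ} (hZ : ∀ i, Measurable (Z i))
    (hind : iIndepFun Z μ) {K : ℝ} (hK : 0 < K) (hK2 : 1 ≤ 2 * K ^ 2)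
    (hmgf : ∀ i, ∀ s : ℝ, |s| ≤ 1 / (96 * K ^ 2) →
      Integrable (fun ω => Real.exp (s * Z i ω)) μ ∧
      ∫ ω, Real.exp (s * Z i ω) ∂μ ≤ Real.exp (73728 * s ^ 2 * K ^ 4)) {u : ℝ} (hu : 0 ≤ u) :
    μ.real {ω | u * N ≤ |∑ i, Z i ω|} ≤
      2 * Real.exp (-(min u 1 * u * N / (294912 * K ^ 4))) := by
  -- For `u ≤ 1` this minimises `-l u + 73728 l² K⁴`; truncating `u` at 1 keeps `l` in the range
  -- where the moment generating function is controlled.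
  set l := min u 1 / (147456 * K ^ 4) with hl
  have hm0 : 0 ≤ min u 1 := le_min hu zero_le_one
  have hl0 : 0 ≤ l := by positivity
  have hl1 : l ≤ 1 / (96 * K ^ 2) := by
    rw [hl, div_le_div_iff₀ (by positivity) (by positivity)]
    have : min u 1 ≤ 1 := min_le_right _ _
    have hK4 : K ^ 2 ≤ 2 * K ^ 4 := by nlinarith [sq_nonneg K]
    nlinarith [sq_nonneg K, mul_le_mul_of_nonneg_right this (sq_nonneg K)]
  have hsum : ∀ s : ℝ, |s| = l → Integrable (fun ω => Real.exp (s * (∑ i, Z i) ω)) μ ∧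
      mgf (∑ i, Z i) μ s ≤ Real.exp (73728 * l ^ 2 * K ^ 4 * N) := by
    intro s hs
    have hs' : |s| ≤ 1 / (96 * K ^ 2) := hs.trans_le hl1
    refine ⟨hind.integrable_exp_mul_sum hZ fun i _ => (hmgf i s hs').1, ?_⟩
    rw [hind.mgf_sum hZ]
    calc ∏ i, mgf (Z i) μ s ≤ ∏ _i : Fin N, Real.exp (73728 * s ^ 2 * K ^ 4) :=
          Finset.prod_le_prod (fun _ _ => mgf_nonneg) fun i _ => (hmgf i s hs').2
      _ = _ := by
          rw [Finset.prod_const, Finset.card_univ, Fintype.card_fin, ← Real.exp_nat_mul, ← hs,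
            sq_abs]
          congr 1; ring
  have hexp : Real.exp (-l * (u * N)) * Real.exp (73728 * l ^ 2 * K ^ 4 * N) ≤
      Real.exp (-(min u 1 * u * N / (294912 * K ^ 4))) := by
    rw [← Real.exp_add, Real.exp_le_exp]
    have h1 : 73728 * l ^ 2 * K ^ 4 * N = min u 1 * min u 1 * N / (294912 * K ^ 4) := by
      rw [hl]; field_simp; ring
    have h2 : l * (u * N) = 2 * (min u 1 * u * N / (294912 * K ^ 4)) := by
      rw [hl]; field_simp; ring
    have h3 : min u 1 * min u 1 * N / (294912 * K ^ 4) ≤ min u 1 * u * N / (294912 * K ^ 4) := by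
      gcongr
      exact min_le_left _ _
    linarith
  have hup := (measure_ge_le_exp_mul_mgf (u * N) hl0 (hsum l (abs_of_nonneg hl0)).1).trans
    ((mul_le_mul_of_nonneg_left (hsum l (abs_of_nonneg hl0)).2 (Real.exp_pos _).le).trans hexp)
  have hlo := (measure_le_le_exp_mul_mgf (-(u * N)) (neg_nonpos.2 hl0)
    (hsum (-l) (by rw [abs_neg, abs_of_nonneg hl0])).1).trans
    ((mul_le_mul_of_nonneg_left (hsum (-l) (by rw [abs_neg, abs_of_nonneg hl0])).2
      (Real.exp_pos _).le).trans (le_of_eq_of_le (by rw [neg_neg, mul_neg, ← neg_mul]) hexp))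
  have hsub : {ω | u * N ≤ |∑ i, Z i ω|} ⊆
      {ω | u * N ≤ (∑ i, Z i) ω} ∪ {ω | (∑ i, Z i) ω ≤ -(u * N)} := by
    intro ω hω
    rcases le_abs'.1 (Set.mem_ofPred_eq ▸ hω) with h | h
    · right; simpa using h
    · left; simpa using h
  calc μ.real {ω | u * N ≤ |∑ i, Z i ω|} ≤ _ := measureReal_mono hsub
    _ ≤ _ := measureReal_union_le _ _
    _ ≤ _ := by linarith

/-! ### Nets on the sphere and operator norms. -/

/-- The unit sphere of a `d`-dimensional Euclidean space has a `1/2`-net of at most `5 ^ d`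
points. -/
lemma exists_half_net_sphere (E : Type*) [NormedAddCommGroup E] [InnerProductSpace ℝ E]
    [FiniteDimensional ℝ E] :
    ∃ S : Finset E, (∀ y ∈ S, ‖y‖ = 1) ∧ S.card ≤ 5 ^ Module.finrank ℝ E ∧
      ∀ x : E, ‖x‖ = 1 → ∃ y ∈ S, ‖x - y‖ < 1 / 2 := by
  classical
  let P : Finset E → Prop := fun S =>
    (∀ y ∈ S, ‖y‖ = 1) ∧ ∀ y ∈ S, ∀ z ∈ S, y ≠ z → 1 / 2 ≤ ‖y - z‖
  have hcard : ∀ S, P S → S.card ≤ 5 ^ Module.finrank ℝ E := by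
    intro S hS
    -- Doubling turns separation `1/2` on the unit sphere into separation 1 in the ball of radius 2,
    -- the setting of the Besicovitch packing bound.
    have hinj : Function.Injective (fun y : E => (2 : ℝ) • y) :=
      smul_right_injective E (two_ne_zero)
    rw [← Finset.card_image_of_injective S hinj]
    refine Besicovitch.card_le_of_separated _ ?_ ?_
    · intro c hc
      obtain ⟨y, hy, rfl⟩ := Finset.mem_image.1 hc
      simp [norm_smul, hS.1 y hy]
    · intro c hc d hd hcd
      obtain ⟨y, hy, rfl⟩ := Finset.mem_image.1 hc
      obtain ⟨z, hz, rfl⟩ := Finset.mem_image.1 hd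
      have := hS.2 y hy z hz (fun h => hcd (by rw [h]))
      rw [← smul_sub, norm_smul, Real.norm_two]
      linarith
  -- A `1/2`-separated set of largest cardinality is a net: a point far from all of it could be
  -- added.
  let Q : ℕ → Prop := fun k => ∃ S, P S ∧ S.card = k
  have hQ0 : Q 0 := ⟨∅, by simp [P], rfl⟩
  obtain ⟨S, hS, hSk⟩ := Nat.findGreatest_spec (P := Q) (Nat.zero_le (5 ^ Module.finrank ℝ E)) hQ0
  refine ⟨S, hS.1, hcard S hS, fun x hx => ?_⟩
  by_contra! hfar
  have hxS : x ∉ S := fun h => by have := hfar x h; norm_num at this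
  have hP : P (insert x S) := by
    refine ⟨?_, ?_⟩
    · intro y hy
      rcases Finset.mem_insert.1 hy with rfl | hy
      exacts [hx, hS.1 y hy]
    · intro y hy z hz hyz
      rcases Finset.mem_insert.1 hy with hyx | hyS <;>
        rcases Finset.mem_insert.1 hz with hzx | hzS
      · exact absurd (hyx.trans hzx.symm) hyz
      · rw [hyx]; exact hfar z hzS
      · rw [hzx, norm_sub_rev]; exact hfar y hyS
      · exact hS.2 y hyS z hzS hyz
  have := Nat.le_findGreatest (P := Q) (hcard _ hP) ⟨_, hP, rfl⟩
  rw [Finset.card_insert_of_notMem hxS, hSk] at this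
  omega

/-- The norm of a symmetric operator is controlled by its quadratic form on a `1/2`-net of the
sphere. -/
lemma norm_le_of_half_net {E : Type*} [NormedAddCommGroup E] [InnerProductSpace ℝ E]
    (T : E →L[ℝ] E) (hT : T.IsSymmetric) {S : Finset E} (hS1 : ∀ y ∈ S, ‖y‖ = 1)
    (hS : ∀ x : E, ‖x‖ = 1 → ∃ y ∈ S, ‖x - y‖ < 1 / 2) {m : ℝ} (hm : 0 ≤ m)
    (h : ∀ y ∈ S, |inner ℝ (T y) y| ≤ m) : ‖T‖ ≤ 32 * m := by
  have key : ∀ x : E, ‖x‖ = 1 → |inner ℝ (T x) x| ≤ m + 31 / 32 * ‖T‖ := by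
    intro x hx
    obtain ⟨y, hy, hxy⟩ := hS x hx
    have hid : inner ℝ (T x) x = inner ℝ (T y) y + inner ℝ (T (x - y)) (x + y) := by
      have h1 : inner ℝ (T y) x = inner ℝ (T x) y := by
        rw [← real_inner_comm]; exact (hT x y).symm
      rw [map_sub, inner_sub_left, inner_add_right, inner_add_right, h1]
      ring
    have hpar := parallelogram_law_with_norm ℝ x y
    rw [hx, hS1 y hy] at hpar
    -- The triangle inequality gives only 1 here, which is useless. The parallelogram law gives
    -- `√(15/16) < 31/32`, and the gap `1/32` produces the factor 32.
    have hprod : ‖x - y‖ * ‖x + y‖ ≤ 31 / 32 := by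
      refine abs_le_of_sq_le_sq' ?_ (by norm_num) |>.2
      have h0 := norm_nonneg (x - y)
      have : ‖x - y‖ ^ 2 ≤ 1 / 4 := by nlinarith
      rw [mul_pow, show ‖x + y‖ ^ 2 = 4 - ‖x - y‖ ^ 2 by nlinarith]
      nlinarith
    have hb : |inner ℝ (T (x - y)) (x + y)| ≤ 31 / 32 * ‖T‖ := by
      calc |inner ℝ (T (x - y)) (x + y)| ≤ ‖T (x - y)‖ * ‖x + y‖ := abs_real_inner_le_norm _ _
        _ ≤ ‖T‖ * ‖x - y‖ * ‖x + y‖ := by gcongr; exact T.le_opNorm _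
        _ = ‖T‖ * (‖x - y‖ * ‖x + y‖) := by ring
        _ ≤ ‖T‖ * (31 / 32) := by gcongr
        _ = _ := by ring
    rw [hid]
    exact (abs_add_le _ _).trans (add_le_add (h y hy) hb)
  have hle : ‖T‖ ≤ m + 31 / 32 * ‖T‖ := by
    conv_lhs => rw [T.norm_eq_iSup_rayleighQuotient hT]
    refine ciSup_le fun x => ?_
    rcases eq_or_ne x 0 with rfl | hx
    · simp; positivity
    · have hx' : ‖x‖ ≠ 0 := norm_ne_zero_iff.2 hx
      rw [← T.rayleigh_smul x (inv_ne_zero hx')]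
      have hn : ‖(‖x‖⁻¹ : ℝ) • x‖ = 1 := by
        rw [norm_smul, norm_inv, norm_norm, inv_mul_cancel₀ hx']
      have := key _ hn
      rw [ContinuousLinearMap.rayleighQuotient, hn, ContinuousLinearMap.reApplyInnerSelf_apply]
      rw [one_pow, div_one]
      exact this
  linarith

/-! ### Gram matrices as real symmetric operators, and singular values. -/

/-- Quaternion column vectors with the Euclidean norm of the underlying real vectors. -/
abbrev QuaternionVec (n : ℕ) : Type := PiLp 2 (fun _ : Fin n => Quaternion ℝ)

lemma finrank_quaternionVec (n : ℕ) : Module.finrank ℝ (QuaternionVec n) = 4 * n := by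
  rw [(WithLp.linearEquiv 2 ℝ (Fin n → Quaternion ℝ)).finrank_eq, Module.finrank_pi_fintype]
  simp [Quaternion.finrank_eq_four, mul_comm]

/-- Left multiplication by a quaternion matrix as a real linear operator. -/
noncomputable def toRealLin {n : ℕ} (B : Matrix (Fin n) (Fin n) (Quaternion ℝ)) :
    QuaternionVec n →L[ℝ] QuaternionVec n :=
  LinearMap.toContinuousLinearMap
    { toFun := fun x => WithLp.toLp 2 (B *ᵥ WithLp.ofLp x)
      map_add' := fun x y => by rw [WithLp.ofLp_add, Matrix.mulVec_add, WithLp.toLp_add]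
      map_smul' := fun r x => by
        rw [WithLp.ofLp_smul, Matrix.mulVec_smul, WithLp.toLp_smul]; rfl }

lemma toRealLin_apply {n : ℕ} (B : Matrix (Fin n) (Fin n) (Quaternion ℝ)) (x : QuaternionVec n) :
    toRealLin B x = WithLp.toLp 2 (B *ᵥ WithLp.ofLp x) := rfl

lemma inner_toLp_eq_re {n : ℕ} (x y : Fin n → Quaternion ℝ) :
    inner ℝ (WithLp.toLp 2 x : QuaternionVec n) (WithLp.toLp 2 y) = (star y ⬝ᵥ x).re := by
  have hre : ∀ f : Fin n → Quaternion ℝ, (∑ j, f j).re = ∑ j, (f j).re := fun f =>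
    map_sum (QuaternionAlgebra.reₗ (-1 : ℝ) 0 (-1)) f _
  rw [PiLp.inner_apply, dotProduct, hre]
  refine Finset.sum_congr rfl fun j _ => ?_
  rw [Quaternion.inner_def]
  simp
  ring

/-- The real inner product is the real part of the quaternionic Hermitian form, for which `Aᴴ` is
the adjoint of `A`. -/
lemma inner_gram {N n : ℕ} (A : Matrix (Fin N) (Fin n) (Quaternion ℝ)) (x y : QuaternionVec n) :
    inner ℝ (toRealLin (Aᴴ * A) x) y =
      inner ℝ (WithLp.toLp 2 (A *ᵥ WithLp.ofLp x) : QuaternionVec N)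
        (WithLp.toLp 2 (A *ᵥ WithLp.ofLp y)) := by
  rw [toRealLin_apply, show y = WithLp.toLp 2 (WithLp.ofLp y) from rfl, inner_toLp_eq_re,
    inner_toLp_eq_re, ← Matrix.mulVec_mulVec, Matrix.dotProduct_mulVec, ← Matrix.star_mulVec]

lemma isSymmetric_gram {N n : ℕ} (A : Matrix (Fin N) (Fin n) (Quaternion ℝ)) :
    (toRealLin (Aᴴ * A)).IsSymmetric := fun x y => by
  change inner ℝ (toRealLin (Aᴴ * A) x) y = inner ℝ x (toRealLin (Aᴴ * A) y)
  rw [inner_gram, ← real_inner_comm x, inner_gram, real_inner_comm]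

/-- A symmetric real operator has a real eigenvalue, nonnegative here because `l‖v‖² = ‖Av‖²`.
Nonemptiness is needed because `sInf` and `sSup` of the empty set default to 0. -/
lemma singularValues_nonempty {N n : ℕ} (hn : 1 ≤ n)
    (A : Matrix (Fin N) (Fin n) (Quaternion ℝ)) : (singularValues A).Nonempty := by
  have hpos : 0 < Module.finrank ℝ (QuaternionVec n) := by rw [finrank_quaternionVec]; omega
  have : Nontrivial (QuaternionVec n) := Module.nontrivial_of_finrank_pos hpos
  obtain ⟨v, hv⟩ :=
    (isSymmetric_gram A).hasEigenvalue_iSup_of_finiteDimensional.exists_hasEigenvector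
  set l : ℝ := _
  have hv1 : toRealLin (Aᴴ * A) v = l • v := hv.apply_eq_smul
  have hl : 0 ≤ l := by
    have h1 := inner_gram A v v
    rw [hv1, real_inner_smul_left, real_inner_self_eq_norm_sq, real_inner_self_eq_norm_sq] at h1
    have h2 : 0 < ‖v‖ ^ 2 := by have := norm_pos_iff.2 hv.2; positivity
    by_contra! hneg
    nlinarith [mul_neg_of_neg_of_pos hneg h2, sq_nonneg
      ‖(WithLp.toLp 2 (A *ᵥ WithLp.ofLp v) : QuaternionVec N)‖]
  refine ⟨√l, Real.sqrt_nonneg _, WithLp.ofLp v, fun h => hv.2 ?_, ?_⟩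
  · exact (WithLp.ofLp_eq_zero 2).1 h
  · rw [Real.sq_sqrt hl]
    exact congrArg WithLp.ofLp hv1

/-- If `AᴴA` is close to `r²`, all singular values of `A` are close to `r`. -/
lemma abs_singularValue_sub_le {N n : ℕ} {A : Matrix (Fin N) (Fin n) (Quaternion ℝ)}
    {r δ : ℝ} (hr : 0 < r) (hδ : 0 ≤ δ)
    (h : ‖toRealLin (Aᴴ * A) - (r ^ 2) • ContinuousLinearMap.id ℝ (QuaternionVec n)‖ ≤
      r ^ 2 * max δ (δ ^ 2)) {s : ℝ} (hs : s ∈ singularValues A) : |s - r| ≤ r * δ := by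
  obtain ⟨hs0, x, hx, hAx⟩ := hs
  set v : QuaternionVec n := WithLp.toLp 2 x
  have hv : 0 < ‖v‖ := norm_pos_iff.2 fun h => hx ((WithLp.toLp_eq_zero 2).1 h)
  have h1 : (toRealLin (Aᴴ * A) - (r ^ 2) • ContinuousLinearMap.id ℝ (QuaternionVec n)) v =
      (s ^ 2 - r ^ 2) • v := by
    rw [sub_smul]
    exact congrArg (fun w => WithLp.toLp 2 w - r ^ 2 • v) hAx
  have h2 : |s ^ 2 - r ^ 2| ≤ r ^ 2 * max δ (δ ^ 2) := by
    have h3 := ContinuousLinearMap.le_of_opNorm_le _ h v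
    rw [h1, norm_smul, Real.norm_eq_abs] at h3
    exact le_of_mul_le_mul_right h3 hv
  have hprod : |s ^ 2 - r ^ 2| = |s - r| * (s + r) := by
    rw [← abs_of_nonneg (by positivity : 0 ≤ s + r), ← abs_mul]
    ring_nf
  rw [hprod] at h2
  by_contra! hlt
  -- In `|s² - r²| = |s - r|(s + r)`, the bound `s + r ≥ r` settles the case `max = δ`, and `s + r ≥
  -- |s - r|` the case `max = δ²`.
  have ha : |s - r| ≤ s + r := by
    rw [abs_le]; constructor <;> linarith
  have h0 : 0 ≤ r * δ := by positivity
  rcases max_choice δ (δ ^ 2) with hmax | hmax <;> rw [hmax] at h2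
  · nlinarith
  · nlinarith

/-! ### Quaternion products as real marginals of a row. -/

/-- The coefficient vector of the `k`-th real component of `a ↦ ∑ j, a j * x j`. -/
def rowCoeff {n : ℕ} (x : Fin n → Quaternion ℝ) (k : Fin 4) : Fin 4 × Fin n → ℝ := fun p =>
  (![![(x p.2).re, -(x p.2).imI, -(x p.2).imJ, -(x p.2).imK],
    ![(x p.2).imI, (x p.2).re, (x p.2).imK, -(x p.2).imJ],
    ![(x p.2).imJ, -(x p.2).imK, (x p.2).re, (x p.2).imI],
    ![(x p.2).imK, (x p.2).imJ, -(x p.2).imI, (x p.2).re]] : Fin 4 → Fin 4 → ℝ) k p.1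

lemma quaternion_norm_sq (q : Quaternion ℝ) :
    ‖q‖ ^ 2 = q.re ^ 2 + q.imI ^ 2 + q.imJ ^ 2 + q.imK ^ 2 := by
  rw [sq, ← Quaternion.normSq_eq_norm_mul_self, Quaternion.normSq_def']

/-- Each row of the coefficient table is a signed permutation of the components of `x j`. So a unit
`x` yields four unit directions, to which isotropy and the bound `K` apply. -/
lemma rowCoeff_dotProduct_self {n : ℕ} (x : Fin n → Quaternion ℝ) (k : Fin 4) :
    rowCoeff x k ⬝ᵥ rowCoeff x k = ‖(WithLp.toLp 2 x : QuaternionVec n)‖ ^ 2 := by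
  rw [PiLp.norm_sq_eq_of_L2, dotProduct, Fintype.sum_prod_type_right]
  refine Finset.sum_congr rfl fun j _ => ?_
  rw [quaternion_norm_sq, Fin.sum_univ_four]
  fin_cases k <;> simp [rowCoeff] <;> ring

lemma norm_sq_dotProduct_eq {n : ℕ} (a x : Fin n → Quaternion ℝ) :
    ‖a ⬝ᵥ x‖ ^ 2 = ∑ k, (realVec a ⬝ᵥ rowCoeff x k) ^ 2 := by
  have hr : (a ⬝ᵥ x).re = realVec a ⬝ᵥ rowCoeff x 0 := by
    rw [dotProduct, dotProduct, Fintype.sum_prod_type_right]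
    refine (map_sum (QuaternionAlgebra.reₗ (-1 : ℝ) 0 (-1)) _ _).trans
      (Finset.sum_congr rfl fun j _ => (Quaternion.re_mul _ _).trans ?_)
    simp [Fin.sum_univ_four, realVec, rowCoeff]; ring
  have hi : (a ⬝ᵥ x).imI = realVec a ⬝ᵥ rowCoeff x 1 := by
    rw [dotProduct, dotProduct, Fintype.sum_prod_type_right]
    refine (map_sum (QuaternionAlgebra.imIₗ (-1 : ℝ) 0 (-1)) _ _).trans
      (Finset.sum_congr rfl fun j _ => (Quaternion.imI_mul _ _).trans ?_)
    simp [Fin.sum_univ_four, realVec, rowCoeff]; ring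
  have hj : (a ⬝ᵥ x).imJ = realVec a ⬝ᵥ rowCoeff x 2 := by
    rw [dotProduct, dotProduct, Fintype.sum_prod_type_right]
    refine (map_sum (QuaternionAlgebra.imJₗ (-1 : ℝ) 0 (-1)) _ _).trans
      (Finset.sum_congr rfl fun j _ => (Quaternion.imJ_mul _ _).trans ?_)
    simp [Fin.sum_univ_four, realVec, rowCoeff]; ring
  have hk : (a ⬝ᵥ x).imK = realVec a ⬝ᵥ rowCoeff x 3 := by
    rw [dotProduct, dotProduct, Fintype.sum_prod_type_right]
    refine (map_sum (QuaternionAlgebra.imKₗ (-1 : ℝ) 0 (-1)) _ _).trans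
      (Finset.sum_congr rfl fun j _ => (Quaternion.imK_mul _ _).trans ?_)
    simp [Fin.sum_univ_four, realVec, rowCoeff]; ring
  rw [quaternion_norm_sq, hr, hi, hj, hk, Fin.sum_univ_four]

lemma measurable_realVec_dotProduct {n : ℕ} (y : Fin 4 × Fin n → ℝ) :
    Measurable (fun v : Fin n → Quaternion ℝ => realVec v ⬝ᵥ y) := by
  simp only [dotProduct]
  refine Finset.measurable_sum _ fun p _ => Measurable.mul_const ?_ _
  obtain ⟨l, j⟩ := p
  fin_cases l
  · exact Quaternion.continuous_re.measurable.comp (measurable_pi_apply j)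
  · exact Quaternion.continuous_imI.measurable.comp (measurable_pi_apply j)
  · exact Quaternion.continuous_imJ.measurable.comp (measurable_pi_apply j)
  · exact Quaternion.continuous_imK.measurable.comp (measurable_pi_apply j)

lemma IsIsotropic.integral_dotProduct_sq {Ω : Type*} [MeasurableSpace Ω] {μ : Measure Ω} {n : ℕ}
    {v : Ω → Fin n → Quaternion ℝ} (hv : IsIsotropic v μ) (y : Fin 4 × Fin n → ℝ) :
    Integrable (fun ω => (realVec (v ω) ⬝ᵥ y) ^ 2) μ ∧
      ∫ ω, (realVec (v ω) ⬝ᵥ y) ^ 2 ∂μ = y ⬝ᵥ y := by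
  have hexp : (fun ω => (realVec (v ω) ⬝ᵥ y) ^ 2) =
      fun ω => ∑ p, ∑ q, y p * y q * (realVec (v ω) p * realVec (v ω) q) := by
    ext ω
    rw [sq, dotProduct, Finset.sum_mul_sum]
    exact Finset.sum_congr rfl fun p _ => Finset.sum_congr rfl fun q _ => by ring
  have hi : ∀ p q, Integrable (fun ω => y p * y q * (realVec (v ω) p * realVec (v ω) q)) μ :=
    fun p q => (hv p q).1.const_mul _
  rw [hexp]
  refine ⟨integrable_finsetSum _ fun p _ => integrable_finsetSum _ fun q _ => hi p q, ?_⟩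
  rw [integral_finsetSum _ fun p _ => integrable_finsetSum _ fun q _ => hi p q, dotProduct]
  refine Finset.sum_congr rfl fun p _ => ?_
  rw [integral_finsetSum _ fun q _ => hi p q]
  simp only [integral_const_mul, (hv p _).2]
  simp

lemma psi2Norm_le_psi2NormVec {Ω : Type*} [MeasurableSpace Ω] {n : ℕ}
    (v : Ω → Fin n → Quaternion ℝ) (μ : Measure Ω) {y : Fin 4 × Fin n → ℝ} (hy : y ⬝ᵥ y = 1) :
    psi2Norm (fun ω => realVec (v ω) ⬝ᵥ y) μ ≤ psi2NormVec v μ :=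
  le_iSup₂_of_le (f := fun (z : Fin 4 × Fin n → ℝ) (_ : z ⬝ᵥ z = 1) =>
    psi2Norm (fun ω => realVec (v ω) ⬝ᵥ z) μ) y hy le_rfl

/-! ### Finiteness of the sub-Gaussian norm of a vector. -/

/-- Half the tail constant works as exponent: on the layer `m + 1 < ξ² ≤ m + 2` the growth
`exp(c(m+2)/2)` against the tail `exp(1 - c(m+1))` leaves `e · exp(-cm/2)`, which is summable. -/
lemma IsSubGaussian.exists_lintegral_exp_sq_ne_top {Ω : Type*} [MeasurableSpace Ω] {μ : Measure Ω}
    [IsProbabilityMeasure μ] {ξ : Ω → ℝ} (hξ : Measurable ξ) (h : IsSubGaussian ξ μ) :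
    ∃ b : ℝ, 0 < b ∧ ∫⁻ ω, ENNReal.ofReal (Real.exp (b * ξ ω ^ 2)) ∂μ ≠ ⊤ := by
  obtain ⟨c, hc, htail⟩ := h
  refine ⟨c / 2, by positivity, ?_⟩
  let B : ℕ → Set Ω := fun m => {ω | √((m : ℝ) + 1) < |ξ ω|}
  have hB : ∀ m, MeasurableSet (B m) := fun m => measurableSet_lt measurable_const hξ.abs
  have hμB : ∀ m, μ (B m) ≤ ENNReal.ofReal (Real.exp (1 - c * (m + 1))) := fun m => by
    have := htail √((m : ℝ) + 1) (by positivity)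
    rw [Real.sq_sqrt (by positivity)] at this
    exact (ENNReal.le_ofReal_iff_toReal_le (measure_ne_top _ _) (Real.exp_pos _).le).2 this
  have hpt : ∀ ω, ENNReal.ofReal (Real.exp (c / 2 * ξ ω ^ 2)) ≤
      ENNReal.ofReal (Real.exp (c / 2)) + ∑' m : ℕ, (B m).indicator
        (fun _ => ENNReal.ofReal (Real.exp (c / 2 * (m + 2)))) ω := fun ω => by
    rcases le_or_gt (ξ ω ^ 2) 1 with h1 | h1
    · refine le_add_right (ENNReal.ofReal_le_ofReal (Real.exp_le_exp.2 ?_))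
      nlinarith
    · obtain ⟨m, hm⟩ : ∃ m : ℕ, ⌈ξ ω ^ 2⌉₊ = m + 2 := by
        have : 1 < ⌈ξ ω ^ 2⌉₊ := Nat.lt_ceil.2 (by exact_mod_cast h1)
        exact ⟨⌈ξ ω ^ 2⌉₊ - 2, by omega⟩
      have hup : ξ ω ^ 2 ≤ m + 2 := by
        have := Nat.le_ceil (ξ ω ^ 2)
        rw [hm] at this
        exact_mod_cast this
      have hlow : (m : ℝ) + 1 < ξ ω ^ 2 := by
        have : ((m + 1 : ℕ) : ℝ) < ξ ω ^ 2 := Nat.lt_ceil.1 (by omega)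
        exact_mod_cast this
      have hmem : ω ∈ B m := by
        change √((m : ℝ) + 1) < |ξ ω|
        rw [← Real.sqrt_sq_eq_abs]
        exact Real.sqrt_lt_sqrt (by positivity) hlow
      refine le_add_left (le_trans ?_ (ENNReal.le_tsum m))
      rw [Set.indicator_of_mem hmem]
      gcongr
  have hq : Real.exp (-(c / 2)) < 1 := by
    rw [← Real.exp_zero]; exact Real.exp_lt_exp.2 (by linarith)
  refine ne_top_of_le_ne_top ?_ (lintegral_mono hpt)
  rw [lintegral_add_left measurable_const, lintegral_const, measure_univ, mul_one,
    lintegral_tsum fun m => (measurable_const.indicator (hB m)).aemeasurable]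
  refine ENNReal.add_ne_top.2 ⟨ENNReal.ofReal_ne_top, ?_⟩
  have hle : ∀ m : ℕ, ∫⁻ ω, (B m).indicator
      (fun _ => ENNReal.ofReal (Real.exp (c / 2 * (m + 2)))) ω ∂μ ≤
      ENNReal.ofReal (Real.exp 1 * Real.exp (-(c / 2)) ^ m) := fun m => by
    rw [lintegral_indicator_const (hB m)]
    refine (mul_le_mul_right (hμB m) _).trans (le_of_eq ?_)
    rw [← ENNReal.ofReal_mul (Real.exp_pos _).le, ← Real.exp_add, ← Real.exp_nat_mul,
      ← Real.exp_add]
    ring_nf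
  refine ne_top_of_le_ne_top ?_ (ENNReal.tsum_le_tsum hle)
  rw [← ENNReal.ofReal_tsum_of_nonneg (fun m => by positivity)
    ((summable_geometric_of_lt_one (Real.exp_pos _).le hq).mul_left _)]
  exact ENNReal.ofReal_ne_top

lemma psi2Norm_le_of_lintegral_exp_sq_le {Ω : Type*} [MeasurableSpace Ω] {μ : Measure Ω}
    {ξ : Ω → ℝ} {a M : ℝ} (ha : 0 < a) (hM : 1 ≤ M)
    (h : ∫⁻ ω, ENNReal.ofReal (Real.exp (a * ξ ω ^ 2)) ∂μ ≤ ENNReal.ofReal M) :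
    psi2Norm ξ μ ≤ ENNReal.ofReal ((2 * a) ^ (-(1 / 2) : ℝ) * M) := by
  refine iSup₂_le fun p hp => ?_
  have hp0 : 0 < p := by linarith
  have hc : 0 ≤ p / (2 * a) := by positivity
  -- This is `y ≤ exp y` at `y = 2aξ²/p`, raised to the power `p/2`; the `p`-th root then has the
  -- required growth `√p`.
  have hpt : ∀ ω, |ξ ω| ^ p ≤ (p / (2 * a)) ^ (p / 2) * Real.exp (a * ξ ω ^ 2) := fun ω => by
    have h1 : |ξ ω| ^ p = (p / (2 * a)) ^ (p / 2) * (2 * a * ξ ω ^ 2 / p) ^ (p / 2) := by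
      rw [← Real.mul_rpow hc (by positivity),
        show p / (2 * a) * (2 * a * ξ ω ^ 2 / p) = |ξ ω| ^ (2 : ℝ) by
          rw [Real.rpow_two, sq_abs]; field_simp, ← Real.rpow_mul (abs_nonneg _)]
      congr 1; ring
    have h2 : (2 * a * ξ ω ^ 2 / p) ^ (p / 2) ≤ Real.exp (a * ξ ω ^ 2) := by
      calc (2 * a * ξ ω ^ 2 / p) ^ (p / 2)
          ≤ Real.exp (2 * a * ξ ω ^ 2 / p) ^ (p / 2) := by
            refine Real.rpow_le_rpow (by positivity) ?_ (by positivity)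
            linarith [Real.add_one_le_exp (2 * a * ξ ω ^ 2 / p)]
        _ = Real.exp (a * ξ ω ^ 2) := by
            rw [← Real.exp_mul]; congr 1; field_simp
    rw [h1]
    gcongr
  have hint : ∫⁻ ω, ENNReal.ofReal (|ξ ω| ^ p) ∂μ ≤
      ENNReal.ofReal ((p / (2 * a)) ^ (p / 2) * M) := by
    calc ∫⁻ ω, ENNReal.ofReal (|ξ ω| ^ p) ∂μ
        ≤ ∫⁻ ω, ENNReal.ofReal ((p / (2 * a)) ^ (p / 2)) *
          ENNReal.ofReal (Real.exp (a * ξ ω ^ 2)) ∂μ := lintegral_mono fun ω => by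
            rw [← ENNReal.ofReal_mul (by positivity)]
            exact ENNReal.ofReal_le_ofReal (hpt ω)
      _ = ENNReal.ofReal ((p / (2 * a)) ^ (p / 2)) *
          ∫⁻ ω, ENNReal.ofReal (Real.exp (a * ξ ω ^ 2)) ∂μ :=
            lintegral_const_mul' _ _ ENNReal.ofReal_ne_top
      _ ≤ _ := by
            rw [ENNReal.ofReal_mul (by positivity)]
            gcongr
  calc _ ≤ ENNReal.ofReal (p ^ (-(1 / 2) : ℝ)) *
        ENNReal.ofReal ((p / (2 * a)) ^ (p / 2) * M) ^ (1 / p) := by gcongr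
    _ = ENNReal.ofReal ((2 * a) ^ (-(1 / 2) : ℝ) * M ^ (1 / p)) := by
        rw [ENNReal.ofReal_rpow_of_nonneg (by positivity) (by positivity),
          ← ENNReal.ofReal_mul (by positivity), Real.mul_rpow (by positivity) (by positivity),
          ← Real.rpow_mul hc, show p / 2 * (1 / p) = 1 / 2 by field_simp,
          Real.div_rpow hp0.le (by positivity), Real.rpow_neg hp0.le,
          Real.rpow_neg (by positivity)]
        congr 1
        field_simp
    _ ≤ _ := by
        gcongr
        calc M ^ (1 / p) ≤ M ^ (1 : ℝ) :=
              Real.rpow_le_rpow_of_exponent_le hM ((div_le_one hp0).2 hp)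
          _ = M := Real.rpow_one M

/-- The hypothesis gives a constant for each direction, with no uniformity over the sphere. By
Cauchy–Schwarz a unit marginal is dominated by the largest of the `d` coordinates, so the smallest
coordinate exponent divided by `d` serves all directions at once. -/
lemma IsSubGaussianVec.psi2NormVec_ne_top {Ω : Type*} [MeasurableSpace Ω] {μ : Measure Ω}
    [IsProbabilityMeasure μ] {n : ℕ} (hn : 1 ≤ n) {v : Ω → Fin n → Quaternion ℝ}
    (hv : Measurable v) (h : IsSubGaussianVec v μ) : psi2NormVec v μ ≠ ⊤ := by
  have hcoord : ∀ p, Measurable fun ω => realVec (v ω) p := fun p => by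
    simpa [Function.comp_def] using (measurable_realVec_dotProduct (Pi.single p 1)).comp hv
  have hsub : ∀ p, IsSubGaussian (fun ω => realVec (v ω) p) μ := fun p => by
    simpa using h (Pi.single p 1)
  choose b hb hbtop using fun p => (hsub p).exists_lintegral_exp_sq_ne_top (hcoord p)
  have : Nonempty (Fin 4 × Fin n) := ⟨(0, ⟨0, hn⟩)⟩
  obtain ⟨p₀, hp₀⟩ := Finite.exists_min b
  set d : ℝ := (Fintype.card (Fin 4 × Fin n) : ℝ) with hd_def
  have hd : 0 < d := by rw [hd_def]; exact_mod_cast Fintype.card_pos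
  set I : ℝ≥0∞ := ∑ p, ∫⁻ ω, ENNReal.ofReal (Real.exp (b p * realVec (v ω) p ^ 2)) ∂μ
  have hI : I ≠ ⊤ := ENNReal.sum_ne_top.2 fun p _ => hbtop p
  have hpt : ∀ x : Fin 4 × Fin n → ℝ, x ⬝ᵥ x = 1 → ∀ ω,
      Real.exp (b p₀ / d * (realVec (v ω) ⬝ᵥ x) ^ 2) ≤
        ∑ p, Real.exp (b p * realVec (v ω) p ^ 2) := by
    intro x hx ω
    have hcs : (realVec (v ω) ⬝ᵥ x) ^ 2 ≤ ∑ p, realVec (v ω) p ^ 2 := by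
      have hx' : ∑ p, x p ^ 2 = 1 := by
        rw [← hx, dotProduct]; exact Finset.sum_congr rfl fun p _ => sq _
      have := Finset.sum_mul_sq_le_sq_mul_sq Finset.univ (realVec (v ω)) x
      rwa [hx', mul_one] at this
    obtain ⟨q, -, hq⟩ := Finset.exists_max_image Finset.univ
      (fun p => realVec (v ω) p ^ 2) Finset.univ_nonempty
    have hsum : ∑ p, realVec (v ω) p ^ 2 ≤ d * realVec (v ω) q ^ 2 := by
      refine (Finset.sum_le_card_nsmul _ _ _ hq).trans (le_of_eq ?_)
      rw [nsmul_eq_mul, Finset.card_univ]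
    have hle : b p₀ / d * (realVec (v ω) ⬝ᵥ x) ^ 2 ≤ b q * realVec (v ω) q ^ 2 := by
      calc b p₀ / d * (realVec (v ω) ⬝ᵥ x) ^ 2 ≤ b p₀ / d * (d * realVec (v ω) q ^ 2) := by
            have := hb p₀
            gcongr
            exact hcs.trans hsum
        _ = b p₀ * realVec (v ω) q ^ 2 := by field_simp
        _ ≤ _ := by gcongr; exact hp₀ q
    exact (Real.exp_le_exp.2 hle).trans (Finset.single_le_sum
      (f := fun p => Real.exp (b p * realVec (v ω) p ^ 2)) (fun p _ => (Real.exp_pos _).le)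
      (Finset.mem_univ q))
  have hbound : psi2NormVec v μ ≤
      ENNReal.ofReal ((2 * (b p₀ / d)) ^ (-(1 / 2) : ℝ) * max 1 I.toReal) := by
    refine iSup₂_le fun x hx => psi2Norm_le_of_lintegral_exp_sq_le (div_pos (hb p₀) hd)
      (le_max_left _ _) ?_
    calc _ ≤ ∫⁻ ω, ∑ p, ENNReal.ofReal (Real.exp (b p * realVec (v ω) p ^ 2)) ∂μ :=
          lintegral_mono fun ω => by
            rw [← ENNReal.ofReal_sum_of_nonneg fun p _ => (Real.exp_pos _).le]
            exact ENNReal.ofReal_le_ofReal (hpt x hx ω)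
      _ = I := lintegral_finsetSum _ fun p _ =>
          (((hcoord p).pow_const 2).const_mul (b p)).exp.ennreal_ofReal
      _ = ENNReal.ofReal I.toReal := (ENNReal.ofReal_toReal hI).symm
      _ ≤ _ := ENNReal.ofReal_le_ofReal (le_max_right _ _)
  exact ne_top_of_le_ne_top ENNReal.ofReal_ne_top hbound

/-! ### Concentration on the net and the union bound. -/

/-- The one-dimensional marginals of an isotropic vector in unit directions force its sub-Gaussian
norm to be bounded below. -/
lemma IsIsotropic.one_le_two_mul_sq {Ω : Type*} [MeasurableSpace Ω] {μ : Measure Ω} {n : ℕ}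
    (hn : 1 ≤ n) {v : Ω → Fin n → Quaternion ℝ} (hv : IsIsotropic v μ) {K : ℝ} (hK : 0 ≤ K)
    (hpsi : psi2NormVec v μ ≤ ENNReal.ofReal K) : 1 ≤ 2 * K ^ 2 := by
  let y : Fin 4 × Fin n → ℝ := Pi.single (0, ⟨0, hn⟩) 1
  have hy : y ⬝ᵥ y = 1 := by simp [y]
  have h2 := hv.integral_dotProduct_sq y
  exact one_le_two_mul_sq_of_variance hK ((psi2Norm_le_psi2NormVec v μ hy).trans hpsi) h2.1
    (h2.2.trans hy)

/-- Concentration of `‖A x‖²` around `4 N` for a fixed unit vector `x`. -/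
lemma measure_norm_mulVec_deviation_le {Ω : Type*} [MeasurableSpace Ω] {μ : Measure Ω}
    [IsProbabilityMeasure μ] {N n : ℕ}
    {A : Ω → Matrix (Fin N) (Fin n) (Quaternion ℝ)}
    (hmeas : ∀ i, Measurable (fun ω => A ω i)) (hind : iIndepFun (fun i ω => A ω i) μ)
    (hiso : ∀ i, IsIsotropic (fun ω => A ω i) μ) {K : ℝ} (hK : 0 < K) (hK2 : 1 ≤ 2 * K ^ 2)
    (hpsi : ∀ i, psi2NormVec (fun ω => A ω i) μ ≤ ENNReal.ofReal K)
    {x : QuaternionVec n} (hx : ‖x‖ = 1) {u : ℝ} (hu : 0 ≤ u) :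
    μ.real {ω | u * N ≤
        |‖(WithLp.toLp 2 (A ω *ᵥ WithLp.ofLp x) : QuaternionVec N)‖ ^ 2 - 4 * N|} ≤
      2 * Real.exp (-(min u 1 * u * N / (294912 * K ^ 4))) := by
  let y : Fin 4 → Fin 4 × Fin n → ℝ := rowCoeff (WithLp.ofLp x)
  have hy : ∀ k, y k ⬝ᵥ y k = 1 := fun k => by
    rw [rowCoeff_dotProduct_self]
    change ‖x‖ ^ 2 = 1
    rw [hx, one_pow]
  have hξm : ∀ i k, Measurable (fun ω => realVec (A ω i) ⬝ᵥ y k) := fun i k =>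
    (measurable_realVec_dotProduct (y k)).comp (hmeas i)
  have hξK : ∀ i k, psi2Norm (fun ω => realVec (A ω i) ⬝ᵥ y k) μ ≤ ENNReal.ofReal K :=
    fun i k => (psi2Norm_le_psi2NormVec _ μ (hy k)).trans (hpsi i)
  have hξ2 := fun i k => (hiso i).integral_dotProduct_sq (y k)
  simp only [hy] at hξ2
  let g : (Fin n → Quaternion ℝ) → ℝ := fun v => ∑ k, (realVec v ⬝ᵥ y k) ^ 2 - 4
  have hg : Measurable g :=
    (Finset.measurable_sum _ fun k _ => (measurable_realVec_dotProduct (y k)).pow_const 2).sub_const 4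
  have hB := measure_abs_sum_ge_le (Z := fun i ω => g (A ω i)) (fun i => hg.comp (hmeas i))
    (hind.comp (fun _ => g) fun _ => hg) hK hK2
    (fun i s hs => mgf_sum_four_sq_le (hξm i) hK (hξK i) (fun k => (hξ2 i k).1)
      (fun k => (hξ2 i k).2) hs) hu
  convert hB using 5 with ω
  rw [PiLp.norm_sq_eq_of_L2]
  simp only [g, Finset.sum_sub_distrib, Finset.sum_const, Finset.card_univ, Fintype.card_fin,
    nsmul_eq_mul]
  rw [mul_comm (N : ℝ) 4]
  refine congrArg (fun r => |r - 4 * (N : ℝ)|) ?_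
  exact Finset.sum_congr rfl fun i _ => norm_sq_dotProduct_eq (A ω i) (WithLp.ofLp x)

/-- A bound for `‖A y‖²` on a net of the sphere bounds all singular values of `A`. -/
lemma sigma_bounds_of_net {N n : ℕ} (hn : 1 ≤ n) (hN : 0 < N)
    {A : Matrix (Fin N) (Fin n) (Quaternion ℝ)} {S : Finset (QuaternionVec n)}
    (hS1 : ∀ y ∈ S, ‖y‖ = 1) (hS : ∀ x : QuaternionVec n, ‖x‖ = 1 → ∃ y ∈ S, ‖x - y‖ < 1 / 2)
    {δ : ℝ} (hδ : 0 ≤ δ)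
    (h : ∀ y ∈ S, |‖(WithLp.toLp 2 (A *ᵥ WithLp.ofLp y) : QuaternionVec N)‖ ^ 2 - 4 * N| ≤
      max δ (δ ^ 2) / 8 * N) :
    2 * √(N : ℝ) - 2 * √(N : ℝ) * δ ≤ sigmaMin A ∧ sigmaMin A ≤ sigmaMax A ∧
      sigmaMax A ≤ 2 * √(N : ℝ) + 2 * √(N : ℝ) * δ := by
  have hN' : (0 : ℝ) < N := by exact_mod_cast hN
  have hr : 0 < 2 * √(N : ℝ) := by positivity
  have hr2 : (2 * √(N : ℝ)) ^ 2 = 4 * N := by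
    rw [mul_pow, Real.sq_sqrt hN'.le]; norm_num
  set T := toRealLin (Aᴴ * A) -
    ((2 * √(N : ℝ)) ^ 2) • ContinuousLinearMap.id ℝ (QuaternionVec n) with hTdef
  have hTapp : ∀ v, T v = toRealLin (Aᴴ * A) v - ((2 * √(N : ℝ)) ^ 2) • v := fun v => rfl
  have hT : T.IsSymmetric := fun v w => by
    change inner ℝ (T v) w = inner ℝ v (T w)
    rw [hTapp, hTapp, inner_sub_left, inner_sub_right, real_inner_smul_left,
      real_inner_smul_right]
    congr 1
    exact isSymmetric_gram A v w
  -- The net factor 32 times `max δ (δ²) / 8 * N` is `r² max δ (δ²)`, since `r² = 4N`; hence the 8.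
  have hTn : ‖T‖ ≤ (2 * √(N : ℝ)) ^ 2 * max δ (δ ^ 2) := by
    refine (norm_le_of_half_net T hT hS1 hS (m := max δ (δ ^ 2) / 8 * N) (by positivity)
      fun y hy => ?_).trans (le_of_eq (by rw [hr2]; ring))
    rw [hTapp, inner_sub_left, inner_gram, real_inner_smul_left, real_inner_self_eq_norm_sq,
      real_inner_self_eq_norm_sq, hS1 y hy, hr2, one_pow, mul_one]
    exact h y hy
  have hs : ∀ s ∈ singularValues A, |s - 2 * √(N : ℝ)| ≤ 2 * √(N : ℝ) * δ := fun s hs =>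
    abs_singularValue_sub_le hr hδ hTn hs
  have hne := singularValues_nonempty hn A
  have hlo : ∀ s ∈ singularValues A, 2 * √(N : ℝ) - 2 * √(N : ℝ) * δ ≤ s := fun s h => by
    linarith [(abs_le.1 (hs s h)).1]
  have hup : ∀ s ∈ singularValues A, s ≤ 2 * √(N : ℝ) + 2 * √(N : ℝ) * δ := fun s h => by
    linarith [(abs_le.1 (hs s h)).2]
  exact ⟨le_csInf hne hlo, csInf_le_csSup hne ⟨_, hlo⟩ ⟨_, hup⟩, csSup_le hne hup⟩

/-- The cardinality of the net is absorbed by the term `C √n` of the deviation. -/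
lemma net_card_mul_exp_le {N n : ℕ} (hn : 1 ≤ n) {K t δ : ℝ} (hK : 0 < K)
    (ht : 0 < t) (hδ : δ * √(N : ℝ) = (12288 * K ^ 2 + 1) * √(n : ℝ) + t) (hδ0 : 0 ≤ δ) :
    5 ^ (4 * n) * (2 * Real.exp (-(min (max δ (δ ^ 2) / 8) 1 * (max δ (δ ^ 2) / 8) * N /
      (294912 * K ^ 4)))) ≤ Real.exp (-(1 / 18874368 * t ^ 2 / K ^ 4)) := by
  have hw : δ ^ 2 ≤ 64 * (min (max δ (δ ^ 2) / 8) 1 * (max δ (δ ^ 2) / 8)) := by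
    set w := max δ (δ ^ 2)
    have h1 : δ ≤ w := le_max_left _ _
    have h2 : δ ^ 2 ≤ w := le_max_right _ _
    have h0 : 0 ≤ w := hδ0.trans h1
    rcases min_choice (w / 8) 1 with hm | hm <;> rw [hm]
    · nlinarith
    · linarith
  -- 12288 is chosen so that `(12288 K²)² = 8 · 64 · 294912 K⁴`: the first term pays `8n`, which
  -- covers the net, and the second leaves the tail in `t`.
  have hNδ : (12288 * K ^ 2) ^ 2 * n + t ^ 2 ≤ δ ^ 2 * N := by
    have : δ ^ 2 * N = ((12288 * K ^ 2 + 1) * √(n : ℝ) + t) ^ 2 := by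
      rw [← hδ, mul_pow, Real.sq_sqrt (Nat.cast_nonneg N)]
    rw [this]
    have hq := Real.sq_sqrt (Nat.cast_nonneg (α := ℝ) n)
    have hq0 := Real.sqrt_nonneg (n : ℝ)
    set q := √(n : ℝ)
    have hc : (0 : ℝ) ≤ 12288 * K ^ 2 := by positivity
    set c := 12288 * K ^ 2
    rw [← hq]
    nlinarith [mul_nonneg hc (sq_nonneg q), mul_nonneg hc (mul_nonneg hq0 ht.le),
      mul_nonneg hq0 ht.le, sq_nonneg q]
  have hexpo : 8 * (n : ℝ) + 1 / 18874368 * t ^ 2 / K ^ 4 ≤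
      min (max δ (δ ^ 2) / 8) 1 * (max δ (δ ^ 2) / 8) * N / (294912 * K ^ 4) := by
    rw [le_div_iff₀ (by positivity)]
    have h3 := mul_le_mul_of_nonneg_right hw (Nat.cast_nonneg (α := ℝ) N)
    have h4 : (8 * (n : ℝ) + 1 / 18874368 * t ^ 2 / K ^ 4) * (294912 * K ^ 4) =
        ((12288 * K ^ 2) ^ 2 * n + t ^ 2) / 64 := by
      field_simp; ring
    rw [h4]
    linarith
  have hcard : (5 : ℝ) ^ (4 * n) * 2 ≤ Real.exp (8 * n) := by
    have h8 : (1250 : ℝ) ≤ Real.exp 8 := by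
      have h1 : (2.5 : ℝ) ^ 8 ≤ Real.exp 1 ^ 8 :=
        pow_le_pow_left₀ (by norm_num) (by linarith [Real.exp_one_gt_d9]) 8
      rw [Real.exp_one_pow] at h1
      norm_num at h1 ⊢
      linarith
    calc (5 : ℝ) ^ (4 * n) * 2 ≤ 625 ^ n * 2 ^ n := by
          rw [pow_mul]
          norm_num
          exact le_self_pow₀ (by norm_num) (by omega)
      _ = 1250 ^ n := by rw [← mul_pow]; norm_num
      _ ≤ Real.exp 8 ^ n := pow_le_pow_left₀ (by norm_num) h8 n
      _ = Real.exp (8 * n) := by rw [← Real.exp_nat_mul]; ring_nf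
  rw [← mul_assoc]
  calc _ ≤ Real.exp (8 * n) * Real.exp (-(8 * (n : ℝ) + 1 / 18874368 * t ^ 2 / K ^ 4)) := by
        gcongr
    _ = _ := by rw [← Real.exp_add]; congr 1; ring

end QuaternionSubGaussian

theorem mainTheorem6 :
    ∃ c : ℝ, 0 < c ∧ ∃ C : ℝ → ℝ, (∀ K : ℝ, 0 < C K) ∧
      ∀ (N n : ℕ), 1 ≤ n → 4 * n < N →
      ∀ (Ω : Type*) [MeasurableSpace Ω] (μ : Measure Ω) [IsProbabilityMeasure μ]
        (A : Ω → Matrix (Fin N) (Fin n) (Quaternion ℝ)),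
        (∀ i, Measurable (fun ω => A ω i)) →
        iIndepFun (fun i ω => A ω i) μ →
        (∀ i, QuaternionSubGaussian.IsSubGaussianVec (fun ω => A ω i) μ) →
        (∀ i, QuaternionSubGaussian.IsIsotropic (fun ω => A ω i) μ) →
        ∀ K : ℝ, K = QuaternionSubGaussian.maxRowPsi2Norm A μ →
        ∀ t : ℝ, 0 < t →
          1 - Real.exp (-(c * t ^ 2 / K ^ 4)) ≤
            μ.real {ω |
              2 * √(N : ℝ) - 2 * C K * √(n : ℝ) - 2 * t
                  ≤ QuaternionSubGaussian.sigmaMin (A ω) ∧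
              QuaternionSubGaussian.sigmaMin (A ω) ≤ QuaternionSubGaussian.sigmaMax (A ω) ∧
              QuaternionSubGaussian.sigmaMax (A ω)
                  ≤ 2 * √(N : ℝ) + 2 * C K * √(n : ℝ) + 2 * t} := by
  -- Here `18874368 = 64 · 294912`; the summand 1 in `C` only secures positivity at `K = 0`.
  refine ⟨1 / 18874368, by norm_num, fun K => 12288 * K ^ 2 + 1, fun K => by positivity, ?_⟩
  intro N n hn hnN Ω _ μ _ A hmeas hind hsub hiso K hKdef t ht
  have hN : 0 < N := by omega
  have hK0 : 0 ≤ K := hKdef ▸ ENNReal.toReal_nonneg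
  have hpsi : ∀ i, QuaternionSubGaussian.psi2NormVec (fun ω => A ω i) μ ≤ ENNReal.ofReal K := by
    intro i
    -- `toReal` sends `⊤` to 0, so `K` bounds the row norms only once the supremum is known to be
    -- finite.
    have htop : (⨆ i : Fin N, QuaternionSubGaussian.psi2NormVec (fun ω => A ω i) μ) ≠ ⊤ := by
      have : Nonempty (Fin N) := ⟨⟨0, hN⟩⟩
      obtain ⟨i₀, hi₀⟩ := exists_eq_ciSup_of_finite
        (f := fun i : Fin N => QuaternionSubGaussian.psi2NormVec (fun ω => A ω i) μ)
      rw [← hi₀]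
      exact (hsub i₀).psi2NormVec_ne_top hn (hmeas i₀)
    rw [hKdef, QuaternionSubGaussian.maxRowPsi2Norm, ENNReal.ofReal_toReal htop]
    exact le_iSup (fun i : Fin N => QuaternionSubGaussian.psi2NormVec (fun ω => A ω i) μ) i
  have hK2 := (hiso ⟨0, hN⟩).one_le_two_mul_sq hn hK0 (hpsi ⟨0, hN⟩)
  have hK : 0 < K := hK0.lt_of_ne' fun h => by rw [h] at hK2; norm_num at hK2
  obtain ⟨S, hS1, hScard, hS⟩ :=
    QuaternionSubGaussian.exists_half_net_sphere (QuaternionSubGaussian.QuaternionVec n)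
  rw [QuaternionSubGaussian.finrank_quaternionVec] at hScard
  have hsqrtN : 0 < √(N : ℝ) := Real.sqrt_pos.2 (by exact_mod_cast hN)
  set δ := ((12288 * K ^ 2 + 1) * √(n : ℝ) + t) / √(N : ℝ) with hδdef
  have hδ0 : 0 ≤ δ := by positivity
  have hδ : δ * √(N : ℝ) = (12288 * K ^ 2 + 1) * √(n : ℝ) + t := div_mul_cancel₀ _ hsqrtN.ne'
  set good : Set Ω := {ω | _} with hgood
  let bad : QuaternionSubGaussian.QuaternionVec n → Set Ω := fun y =>
    {ω | max δ (δ ^ 2) / 8 * N ≤ |‖(WithLp.toLp 2 (A ω *ᵥ WithLp.ofLp y) :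
      QuaternionSubGaussian.QuaternionVec N)‖ ^ 2 - 4 * N|}
  -- Covering the whole space and using subadditivity avoids having to prove that `good` is
  -- measurable.
  have hcover : Set.univ ⊆ good ∪ ⋃ y ∈ S, bad y := by
    intro ω _
    by_cases hω : ω ∈ ⋃ y ∈ S, bad y
    · exact Or.inr hω
    left
    simp only [bad, Set.mem_iUnion, not_exists] at hω
    have hb := QuaternionSubGaussian.sigma_bounds_of_net hn hN (A := A ω) hS1 hS hδ0
      fun y hy => (not_le.1 (hω y hy)).le
    have hδ' : 2 * √(N : ℝ) * δ = 2 * (12288 * K ^ 2 + 1) * √(n : ℝ) + 2 * t := by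
      linear_combination 2 * hδ
    rw [hδ'] at hb
    exact ⟨by linarith [hb.1], hb.2.1, by linarith [hb.2.2]⟩
  have hbad : μ.real (⋃ y ∈ S, bad y) ≤ Real.exp (-(1 / 18874368 * t ^ 2 / K ^ 4)) := by
    refine le_trans ?_ (QuaternionSubGaussian.net_card_mul_exp_le hn hK ht hδ hδ0)
    refine (measureReal_biUnion_finset_le S bad).trans ?_
    refine (Finset.sum_le_sum fun y hy =>
      QuaternionSubGaussian.measure_norm_mulVec_deviation_le hmeas hind hiso hK hK2 hpsi
        (hS1 y hy) (by positivity)).trans ?_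
    rw [Finset.sum_const, nsmul_eq_mul]
    gcongr
    exact_mod_cast hScard
  have h1 : (1 : ℝ) ≤ μ.real good + μ.real (⋃ y ∈ S, bad y) := by
    calc (1 : ℝ) = μ.real Set.univ := by simp
      _ ≤ _ := measureReal_mono hcover
      _ ≤ _ := measureReal_union_le _ _
  linarith
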